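/- Let $k$ be a finite field of characteristic $p$, let $\ell\neq p$ be a prime, let $X$ be a variety over $k$ (a separated connected $k$-scheme of finite type) with a geometric point $\bar x$, let $\overline X$ be a compactification of $X$ (a proper $k$-scheme containing $X$ as a dense open subscheme), and let $D$ be an effective Cartier divisor on $\overline X$ whose support lies in $Z=\overline X\setminus X$. For a closed integral subscheme of $X$ of dimension $1$, let $\phi:C\to X$ be its normalization, let $\overline C$ be the smooth compactification of $C$, let $\overline\phi:\overline C\to\overline X$ be the extension of $\phi$, and for $z\in\overline C\setminus C$ let $k(C)_z$ be the completion of the function field $k(C)$ at $z$. For a complete discrete valuation field $K$ with perfect residue field, let $(G_K^\lambda)_{\lambda}$ be the ramification filtration of $G_K=\mathrm{Gal}(K^{\mathrm{sep}}/K)$ in the upper numbering, and let $G_K^{\lambda+}$ be the closure of $\bigcup_{\lambda'>\lambda}G_K^{\lambda'}$. An étale covering (finite étale morphism) $X'\to X$ has ramification bounded by $D$ if, for all such $\phi:C\to X$ and all $z\in\overline C\setminus C$, every local extension $L=k(C')_{z'}$ of $K=k(C)_z$ (with $C'$ an irreducible component of $C\times_XX'$ and $z'$ a point above $z$ of its smooth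 compactification) satisfies $G_K^{m+}\subset G_L$, where $m$ is the multiplicity of $\overline\phi^{*}D$ at $z$. The group $\pi_1(X,D,\bar x)$ is the fundamental group of the Galois category of these coverings; it is a quotient of $\pi_1(X,\bar x)$. The Swan conductor of a $\overline{\mathbb Q}_\ell$-representation $V$ of $G_K$ is $\mathrm{Sw}(V)=\sum_{\lambda>0}\lambda\dim\bigl(V^{G_K^{\lambda+}}/V^{G_K^{\lambda}}\bigr)$. For a smooth $\overline{\mathbb Q}_\ell$-sheaf $\mathcal F$ on $X$ and an effective Cartier divisor $D'$ on $\overline X$ with support in $Z$, write $\mathrm{Sw}(\mathcal F)\le D'$ if, for every $\phi:C\to X$ as above and every $z\in\overline C\setminus C$, the Swan conductor of the representation of $G_{k(C)_z}$ given by $\mathcal F|_{\mathrm{Spec}\,k(C)_z}$ is at most the multiplicity of $\overline\phi^{*}D'$ at $z$. **Lemma.** Let $\mathcal F$ be a smooth $\overline{\mathbb Q}_\ell$-sheaf on $X$ of rank $r$. If the corresponding representation $\rho:\pi_1(X,\bar x)\to\mathrm{Aut}(\mathcal F_{\bar x})$ factors through $\pi_1(X,D,\bar x)$, then $\mathrm{Sw}(\mathcal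 F)\le rD$. -/

import Mathlib

universe u

open CategoryTheory Limits Opposite AlgebraicGeometry TensorProduct
open scoped ENNReal

noncomputable section

namespace SwanBound

/-! ### Ramification filtrations of a local field

`A` is the valuation ring of a complete discrete valuation field `K`. -/

section Ramification

variable {K : Type u} [Field K] (A : ValuationSubring K)

/-- The ramification subgroup `Gal(L/K)_μ` in the lower numbering: the automorphisms that act
trivially on `O_L / 𝔪_L ^ n`, where `n` is the least natural number `≥ μ + 1`. Here `O_L` is the
integral closure of `A` in `L`; it is a local ring, so its Jacobson radical is `𝔪_L`. -/
def lowerGroup (L : Type u) [Field L] [Algebra K L] (μ : ℝ) : Subgroup Gal(L/K) :=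
  ((Ideal.jacobson (⊥ : Ideal (integralClosure A L))) ^ ⌈μ + 1⌉₊).toAddSubgroup.inertia Gal(L/K)

/-- The Herbrand function `φ_{L/K}(μ) = ∫_0^μ dx / (Gal(L/K)_0 : Gal(L/K)_x)`. -/
def herbrand (L : Type u) [Field L] [Algebra K L] (μ : ℝ) : ℝ :=
  ∫ x in (0 : ℝ)..μ, (((lowerGroup A L x).relIndex (lowerGroup A L 0) : ℕ) : ℝ)⁻¹

/-- The ramification subgroup in the upper numbering: `Gal(L/K)^{φ(μ)} = Gal(L/K)_μ` for
`μ ≥ -1`. (As `φ` is a bijection of `[-1, ∞)`, the supremum is over exactly one `μ`.) -/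
def upperGroup (L : Type u) [Field L] [Algebra K L] (lam : ℝ) : Subgroup Gal(L/K) :=
  ⨆ (μ : ℝ) (_ : -1 ≤ μ) (_ : herbrand A L μ = lam), lowerGroup A L μ

/-- `G_K^λ`, the inverse limit of the `Gal(L/K)^λ` over the finite Galois extensions `L/K` inside
the separable closure. -/
def absUpperGroup (lam : ℝ) : Subgroup Gal(SeparableClosure K/K) :=
  ⨅ (L : IntermediateField K (SeparableClosure K)) (_ : FiniteDimensional K L) (_ : IsGalois K L),
    (upperGroup A L lam).comap (AlgEquiv.restrictNormalHom L)

/-- `G_K^{λ+}`, the closure of the union of the (nested) subgroups `G_K^{λ'}`, `λ' > λ`. -/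
def absUpperGroupPlus (lam : ℝ) : Subgroup Gal(SeparableClosure K/K) :=
  (⨆ (lam' : ℝ) (_ : lam < lam'), absUpperGroup A lam').topologicalClosure

/-- The ramification of the separable extension `i : K → L` is bounded by `λ`:
`G_K^{λ+}` is contained in `Gal(K^sep/L)`, for every embedding `e` of `L` over `K`. -/
def RamificationBounded {L : Type u} [Field L] (i : K →+* L) (lam : ℝ) : Prop :=
  ∀ e : L →+* SeparableClosure K, e.comp i = algebraMap K (SeparableClosure K) →
    ∀ σ ∈ absUpperGroupPlus A lam, ∀ x : L, σ (e x) = e x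

variable {F : Type} [Field F] {V : Type u} [AddCommGroup V] [Module F V]

/-- The subspace `V^H` of vectors fixed by a subgroup `H`. -/
def fixedBy {G : Type u} [Group G] (ρ : Representation F G V) (H : Subgroup G) : Submodule F V :=
  Representation.invariants (ρ.comp H.subtype)

/-- The Swan conductor `∑_{λ > 0} λ dim (V^{G_K^{λ+}} / V^{G_K^λ})`. -/
def swan (ρ : Representation F Gal(SeparableClosure K/K) V) : ℝ≥0∞ :=
  ∑' lam : {t : ℝ // 0 < t}, ENNReal.ofReal lam.1 *
    (Module.finrank F (fixedBy ρ (absUpperGroupPlus A lam.1) ⧸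
      (fixedBy ρ (absUpperGroup A lam.1)).submoduleOf
        (fixedBy ρ (absUpperGroupPlus A lam.1))) : ℝ≥0∞)

end Ramification

/-! ### Étale coverings, fibre functors and fundamental groups -/

/-- A morphism is an étale covering if it is finite étale. -/
def isCovering (X : Scheme.{u}) : ObjectProperty (Over X) :=
  fun Y => IsFinite Y.hom ∧ Etale Y.hom

/-- The category `Cov(X)` of étale coverings of `X`. -/
abbrev Cov (X : Scheme.{u}) : Type (u + 1) := (isCovering X).FullSubcategory

/-- The fibre functor `Y ↦ Hom_X(x, Y)` of a geometric point `x`, on the full subcategory of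
`X`-schemes cut out by `P`. -/
def fibre {X : Scheme.{u}} (P : ObjectProperty (Over X)) {Ω : Type u} [Field Ω]
    (x : Spec (.of Ω) ⟶ X) : P.FullSubcategory ⥤ Type u :=
  P.ι ⋙ coyoneda.obj (op (Over.mk x))

/-- The fundamental group of the Galois category of coverings cut out by `P`, at the geometric
point `x`: the automorphism group of the fibre functor. -/
abbrev fundamentalGroup {X : Scheme.{u}} (P : ObjectProperty (Over X)) {Ω : Type u} [Field Ω]
    (x : Spec (.of Ω) ⟶ X) : Type (u + 1) := Aut (fibre P x)

/-- The homomorphism of fundamental groups induced by the inclusion of a full subcategory. -/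
def restrictHom {X : Scheme.{u}} {P Q : ObjectProperty (Over X)} (h : P ≤ Q) {Ω : Type u}
    [Field Ω] (x : Spec (.of Ω) ⟶ X) : fundamentalGroup Q x →* fundamentalGroup P x where
  toFun σ := Functor.isoWhiskerLeft (ObjectProperty.ιOfLE h) σ
  map_one' := rfl
  map_mul' _ _ := rfl

/-! ### Varieties, compactifications and effective Cartier divisors -/

/-- A variety over `k`: a separated connected scheme of finite type. -/
class IsVariety {k : Type u} [Field k] {X : Scheme.{u}} (s : X ⟶ Spec (.of k)) : Prop where
  separated : IsSeparated s
  locallyOfFiniteType : LocallyOfFiniteType s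
  quasiCompact : QuasiCompact s
  connected : ConnectedSpace X

/-- A compactification of a scheme `X` over `k`. -/
structure Compactification {k : Type u} [Field k] {X : Scheme.{u}} (s : X ⟶ Spec (.of k)) where
  space : Scheme.{u}
  str : space ⟶ Spec (.of k)
  ι : X ⟶ space
  proper : IsProper str
  isOpenImmersion : IsOpenImmersion ι
  dominant : IsDominant ι
  fac : ι ≫ str = s

/-- An effective Cartier divisor: an ideal sheaf that is locally generated by a
non-zero-divisor. -/
def IsCartier {X : Scheme.{u}} (I : X.IdealSheafData) : Prop :=
  ∀ x : X, ∃ U : X.affineOpens, x ∈ U.1 ∧ ∃ f ∈ nonZeroDivisors Γ(X, U), I.ideal U = Ideal.span {f}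

/-- The set `Div_Z(X̄)` of effective Cartier divisors on `X̄` with support in `Z = X̄ ∖ X`. -/
structure BoundaryDivisor {k : Type u} [Field k] {X : Scheme.{u}} {s : X ⟶ Spec (.of k)}
    (Xb : Compactification s) where
  ideal : Xb.space.IdealSheafData
  cartier : IsCartier ideal
  support : Disjoint (ideal.support : Set Xb.space) (Set.range Xb.ι)

/-- The multiple `r D` of an effective Cartier divisor: its local equations are the `r`-th powers
of those of `D`. -/
def BoundaryDivisor.smul {k : Type u} [Field k] {X : Scheme.{u}} {s : X ⟶ Spec (.of k)}
    {Xb : Compactification s} (r : ℕ) (D : BoundaryDivisor Xb) : BoundaryDivisor Xb where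
  ideal := D.ideal ^ r
  cartier x := by
    obtain ⟨U, hx, f, hf, h⟩ := D.cartier x
    refine ⟨U, hx, f ^ r, pow_mem hf r, ?_⟩
    rw [Scheme.IdealSheafData.ideal_pow, Pi.pow_apply, h, Ideal.span_singleton_pow]
  support := by
    rcases Nat.eq_zero_or_pos r with rfl | hr
    · simp
    · rw [Scheme.IdealSheafData.support_pow _ _ hr.ne']
      exact D.support

/-- The stalk at `x` of an ideal sheaf, as an ideal of the local ring at `x`. -/
def stalkIdeal {X : Scheme.{u}} (I : X.IdealSheafData) (x : X) : Ideal (X.presheaf.stalk x) :=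
  ⨆ (U : X.affineOpens) (h : x ∈ U.1), (I.ideal U).map (X.presheaf.germ U.1 x h).hom

/-- The order of a nonzero ideal `J` of a discrete valuation ring: `J = 𝔪 ^ n`. -/
def idealOrder {R : Type u} [CommRing R] [IsLocalRing R] (J : Ideal R) : ℕ :=
  sSup {n : ℕ | J ≤ IsLocalRing.maximalIdeal R ^ n}

/-! ### Curves on a variety, and their points at infinity -/

attribute [instance] Compactification.proper Compactification.isOpenImmersion
  Compactification.dominant IsVariety.separated

/-- A closed integral subscheme `W` of dimension one. -/
structure CurveIn (X : Scheme.{u}) where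
  W : Scheme.{u}
  incl : W ⟶ X
  isClosedImmersion : IsClosedImmersion incl
  integral : IsIntegral W
  dim : topologicalKrullDim W = 1

attribute [instance] CurveIn.isClosedImmersion CurveIn.integral

namespace CurveIn

variable {X : Scheme.{u}} (T : CurveIn X)

/-- The inclusion `Spec k(W) → W` of the generic point. -/
def generic : Spec T.W.functionField ⟶ T.W :=
  T.W.fromSpecStalk (genericPoint T.W)

theorem quasiSeparatedSpace {k : Type u} [Field k] (s : X ⟶ Spec (.of k)) [IsVariety s] :
    QuasiSeparatedSpace T.W :=
  quasiSeparatedSpace_of_quasiSeparated (T.incl ≫ s)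

theorem quasiCompact_generic {k : Type u} [Field k] (s : X ⟶ Spec (.of k)) [IsVariety s] :
    QuasiCompact T.generic :=
  have := T.quasiSeparatedSpace s
  quasiCompact_of_compactSpace T.generic

theorem quasiSeparated_generic : QuasiSeparated T.generic := by
  unfold generic
  infer_instance

/-- The normalization `C` of `W`, that is, the normalization of `W` in its function field. -/
def C {k : Type u} [Field k] (s : X ⟶ Spec (.of k)) [IsVariety s] : Scheme.{u} :=
  have := T.quasiCompact_generic s
  have := T.quasiSeparated_generic
  T.generic.normalization

/-- The canonical morphism `φ : C → W → X`. -/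
def φ {k : Type u} [Field k] (s : X ⟶ Spec (.of k)) [IsVariety s] : T.C s ⟶ X :=
  have := T.quasiCompact_generic s
  have := T.quasiSeparated_generic
  T.generic.fromNormalization ≫ T.incl

end CurveIn

/-- The smooth compactification of a curve: an integral, smooth compactification. Its local rings
away from the generic point are discrete valuation rings. -/
structure SmoothCompactification {k : Type u} [Field k] {C : Scheme.{u}} (s : C ⟶ Spec (.of k))
    extends Compactification s where
  integral : IsIntegral space
  smooth : Smooth str
  regular : ∀ z : space, z ≠ genericPoint space → IsDiscreteValuationRing (space.presheaf.stalk z)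

attribute [instance] SmoothCompactification.integral

/-- A curve `φ : C → X` in `Cu(X)` with its smooth compactification `C̄`, the extension
`φ̄ : C̄ → X̄` of `φ`, and a point `z` of `C̄ ∖ C`. -/
structure PointAtInfinity {k : Type u} [Field k] {X : Scheme.{u}} {s : X ⟶ Spec (.of k)}
    [IsVariety s] (Xb : Compactification s) where
  curve : CurveIn X
  Cb : SmoothCompactification (curve.φ s ≫ s)
  φb : Cb.space ⟶ Xb.space
  φb_str : φb ≫ Xb.str = Cb.str
  ι_φb : Cb.ι ≫ φb = curve.φ s ≫ Xb.ι
  z : Cb.space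
  hz : z ∉ Set.range Cb.ι

namespace PointAtInfinity

variable {k : Type u} [Field k] {X : Scheme.{u}} {s : X ⟶ Spec (.of k)} [IsVariety s]
  {Xb : Compactification s} (P : PointAtInfinity Xb)

theorem mem_range_of_specializes {y : P.Cb.space} (hy : y ⤳ genericPoint P.Cb.space) :
    y ∈ Set.range P.Cb.ι := by
  have ho : IsOpen (Set.range P.Cb.ι) := P.Cb.ι.isOpenEmbedding.isOpen_range
  have hd : DenseRange P.Cb.ι := P.Cb.ι.denseRange
  have : Nonempty P.Cb.space := ⟨P.z⟩
  obtain ⟨w⟩ := hd.nonempty_iff.2 this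
  refine hy.mem_open ho ?_
  exact ((genericPoint_spec P.Cb.space).mem_open_set_iff ho).2 (by simpa using ⟨_, ⟨w, rfl⟩⟩)

theorem ne_genericPoint : P.z ≠ genericPoint P.Cb.space := fun h =>
  P.hz (P.mem_range_of_specializes (h ▸ specializes_rfl))

instance : IsDiscreteValuationRing (P.Cb.space.presheaf.stalk P.z) :=
  P.Cb.regular P.z P.ne_genericPoint

/-- The local field `k(C)_z`: the completion of the function field at `z`. -/
abbrev K : Type u :=
  (IsDiscreteValuationRing.maximalIdeal (P.Cb.space.presheaf.stalk P.z)).adicCompletion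
    P.Cb.space.functionField

/-- The valuation ring of `k(C)_z`. -/
abbrev O : ValuationSubring P.K :=
  (IsDiscreteValuationRing.maximalIdeal (P.Cb.space.presheaf.stalk P.z)).adicCompletionIntegers
    P.Cb.space.functionField

/-- The canonical morphism `Spec k(C)_z → Spec k(C) → C̄`. -/
def specK : Spec (.of P.K) ⟶ P.Cb.space :=
  Spec.map (CommRingCat.ofHom (algebraMap P.Cb.space.functionField P.K)) ≫
    P.Cb.space.fromSpecStalk (genericPoint P.Cb.space)

theorem range_specK : Set.range P.specK ⊆ Set.range P.Cb.ι := by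
  rintro _ ⟨x, rfl⟩
  apply P.mem_range_of_specializes
  have : P.specK x ∈ Set.range (P.Cb.space.fromSpecStalk (genericPoint P.Cb.space)) := by
    simp [specK]
  rwa [Scheme.range_fromSpecStalk] at this

/-- The canonical morphism `Spec k(C)_z → C → X`. -/
def toX : Spec (.of P.K) ⟶ X :=
  IsOpenImmersion.lift P.Cb.ι P.specK P.range_specK ≫ P.curve.φ s

/-- The multiplicity at `z` of the inverse image `φ̄^* D`: the order of the ideal of `𝒪_{C̄,z}`
generated by the pullback of a local equation of `D` at `φ̄(z)`. This ideal is nonzero, because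
`φ̄` maps the generic point of `C̄` into `X`. -/
def mult (D : BoundaryDivisor Xb) : ℕ :=
  idealOrder ((stalkIdeal D.ideal (P.φb P.z)).map (P.φb.stalkMap P.z).hom)

end PointAtInfinity

/-! ### Coverings with bounded ramification -/

/-- The ramification of `Y → X` is bounded by `D`: for every `φ : C → X` in `Cu(X)` and every
point `z` of `C̄ ∖ C`, the local extensions of `k(C)_z` defined by `C ×_X Y → C` have
ramification bounded by the multiplicity of `φ̄^* D` at `z`. These extensions `k(C')_{z'}/k(C)_z`,
where `C'` is an irreducible component of `C ×_X Y` and `z'` lies above `z`, are the residue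
fields of the finite étale `k(C)_z`-scheme `Y ×_X Spec k(C)_z`. -/
def HasBoundedRamification {k : Type u} [Field k] {X : Scheme.{u}} {s : X ⟶ Spec (.of k)}
    [IsVariety s] {Xb : Compactification s} (D : BoundaryDivisor Xb) (Y : Over X) : Prop :=
  ∀ (P : PointAtInfinity Xb) (y : ↥(pullback Y.hom P.toX)),
    RamificationBounded P.O
      (Spec.preimage ((pullback Y.hom P.toX).fromSpecResidueField y ≫ pullback.snd _ _)).hom
      (P.mult D)

/-- The étale coverings of `X` with ramification bounded by `D`. -/
def isBoundedCovering {k : Type u} [Field k] {X : Scheme.{u}} {s : X ⟶ Spec (.of k)}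
    [IsVariety s] {Xb : Compactification s} (D : BoundaryDivisor Xb) : ObjectProperty (Over X) :=
  fun Y => isCovering X Y ∧ HasBoundedRamification D Y

theorem isBoundedCovering_le {k : Type u} [Field k] {X : Scheme.{u}} {s : X ⟶ Spec (.of k)}
    [IsVariety s] {Xb : Compactification s} (D : BoundaryDivisor Xb) :
    isBoundedCovering D ≤ isCovering X :=
  fun _ h => h.1

/-! ### Smooth `ℓ`-adic sheaves -/

/-- The ring of integers `O_E` of a subextension `E` of `ℚ̄_ℓ / ℚ_ℓ`. -/
def IntRing {ℓ : ℕ} [Fact ℓ.Prime] (E : IntermediateField ℚ_[ℓ] (PadicAlgCl ℓ)) : Type :=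
  integralClosure ℤ_[ℓ] E

instance {ℓ : ℕ} [Fact ℓ.Prime] (E : IntermediateField ℚ_[ℓ] (PadicAlgCl ℓ)) :
    CommRing (IntRing E) :=
  inferInstanceAs (CommRing (integralClosure ℤ_[ℓ] E))

instance {ℓ : ℕ} [Fact ℓ.Prime] (E : IntermediateField ℚ_[ℓ] (PadicAlgCl ℓ)) :
    Algebra (IntRing E) (PadicAlgCl ℓ) :=
  inferInstanceAs (Algebra (integralClosure ℤ_[ℓ] E) (PadicAlgCl ℓ))

/-- A smooth `ℚ̄_ℓ`-sheaf on `X`: it is represented by a finite extension `E / ℚ_ℓ` with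
uniformizer `ϖ` and a projective system `(F_n)` of locally constant constructible sheaves of
`O_E`-modules, where `F_n` is killed by `ϖ ^ (n + 1)` and `F_{n+1} / ϖ ^ (n + 1) F_{n+1} ≅ F_n`.
A locally constant constructible sheaf is a sheaf that is represented by an étale covering of `X`;
it is given here together with its inverse images, as a functor on all `X`-schemes. In particular
its stalk at a geometric point `x` is the module of its sections over `x`. -/
structure SmoothSheaf (ℓ : ℕ) [Fact ℓ.Prime] (X : Scheme.{u}) where
  E : IntermediateField ℚ_[ℓ] (PadicAlgCl ℓ)
  finiteDimensional : FiniteDimensional ℚ_[ℓ] E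
  ϖ : IntRing E
  irreducible : Irreducible ϖ
  sheaf : ℕ → (Over X)ᵒᵖ ⥤ ModuleCat.{u} (IntRing E)
  cov : ℕ → Over X
  covering : ∀ n, isCovering X (cov n)
  repr : ∀ n, (sheaf n ⋙ forget _).RepresentableBy (cov n)
  trans : ∀ n, sheaf (n + 1) ⟶ sheaf n
  torsion : ∀ (n : ℕ) (T : (Over X)ᵒᵖ) (a : (sheaf n).obj T), ϖ ^ (n + 1) • a = 0
  trans_surjective : ∀ (n : ℕ) (Ω : Type u) [Field Ω] [IsSepClosed Ω] (x : Spec (.of Ω) ⟶ X),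
    Function.Surjective ((trans n).app (op (Over.mk x)))
  trans_eq_zero_iff : ∀ (n : ℕ) (Ω : Type u) [Field Ω] [IsSepClosed Ω] (x : Spec (.of Ω) ⟶ X)
    (a : (sheaf (n + 1)).obj (op (Over.mk x))),
    (trans n).app (op (Over.mk x)) a = 0 ↔ ∃ b, a = ϖ ^ (n + 1) • b

namespace SmoothSheaf

variable {ℓ : ℕ} [Fact ℓ.Prime] {X : Scheme.{u}} (F : SmoothSheaf ℓ X)

/-- The sections of `F_n` over an `X`-scheme `T`. -/
abbrev sec (n : ℕ) (T : Over X) : Type u := (F.sheaf n).obj (op T)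

/-- The `O_E`-module `lim_n F_n(T)`. -/
def lattice (T : Over X) : Submodule (IntRing F.E) (∀ n, F.sec n T) where
  carrier := {a | ∀ n, (F.trans n).app (op T) (a (n + 1)) = a n}
  add_mem' ha hb n := by simp [ha n, hb n]
  zero_mem' n := by simp
  smul_mem' c a ha n := by simp [ha n]

/-- The stalk `F_x = ℚ̄_ℓ ⊗ lim_n F_{n,x}` (for `T` a geometric point `x`). -/
abbrev stalk (T : Over X) : Type u := PadicAlgCl ℓ ⊗[IntRing F.E] F.lattice T

/-- Compatible endomorphisms of the `F_n(T)` induce an endomorphism of `lim_n F_n(T)`. -/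
def latticeEnd (T : Over X) (f : ∀ n, Module.End (IntRing F.E) (F.sec n T))
    (hf : ∀ n a, (F.trans n).app (op T) (f (n + 1) a) = f n ((F.trans n).app (op T) a)) :
    Module.End (IntRing F.E) (F.lattice T) :=
  (LinearMap.pi fun n => f n ∘ₗ LinearMap.proj n).restrict fun a ha n => by
    change (F.trans n).app (op T) (f (n + 1) (a (n + 1))) = f n (a n)
    rw [hf, ha n]

/-- The endomorphism of the stalk induced by compatible endomorphisms of the `F_n(T)`. -/
def stalkEnd (T : Over X) (f : ∀ n, Module.End (IntRing F.E) (F.sec n T))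
    (hf : ∀ n a, (F.trans n).app (op T) (f (n + 1) a) = f n ((F.trans n).app (op T) a)) :
    Module.End (PadicAlgCl ℓ) (F.stalk T) :=
  (F.latticeEnd T f hf).baseChange (PadicAlgCl ℓ)

theorem stalkEnd_one (T : Over X) (f : ∀ n, Module.End (IntRing F.E) (F.sec n T))
    (hf : ∀ n a, (F.trans n).app (op T) (f (n + 1) a) = f n ((F.trans n).app (op T) a))
    (h : ∀ n a, f n a = a) : F.stalkEnd T f hf = 1 := by
  have : F.latticeEnd T f hf = LinearMap.id :=
    LinearMap.ext fun a => Subtype.ext (funext fun n => h n (a.1 n))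
  rw [stalkEnd, this, LinearMap.baseChange_id]
  rfl

theorem stalkEnd_mul (T : Over X) (f g e : ∀ n, Module.End (IntRing F.E) (F.sec n T))
    (hf : ∀ n a, (F.trans n).app (op T) (f (n + 1) a) = f n ((F.trans n).app (op T) a))
    (hg : ∀ n a, (F.trans n).app (op T) (g (n + 1) a) = g n ((F.trans n).app (op T) a))
    (he : ∀ n a, (F.trans n).app (op T) (e (n + 1) a) = e n ((F.trans n).app (op T) a))
    (h : ∀ n a, f n a = g n (e n a)) :
    F.stalkEnd T f hf = F.stalkEnd T g hg * F.stalkEnd T e he := by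
  have : F.latticeEnd T f hf = F.latticeEnd T g hg ∘ₗ F.latticeEnd T e he :=
    LinearMap.ext fun a => Subtype.ext (funext fun n => h n (a.1 n))
  rw [stalkEnd, this, LinearMap.baseChange_comp]
  rfl

/-! #### The Galois action on the stalk over a field -/

section Galois

variable {K : Type u} [Field K] (a : Spec (.of K) ⟶ X)

/-- The geometric point `Spec K^sep → Spec K → X`. -/
def sepPoint : Over X :=
  Over.mk (Spec.map (CommRingCat.ofHom (algebraMap K (SeparableClosure K))) ≫ a)

/-- The automorphism of the geometric point given by an element of the Galois group. -/
def sepHom (σ : Gal(SeparableClosure K/K)) : sepPoint a ⟶ sepPoint a :=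
  Over.homMk (Spec.map (CommRingCat.ofHom (σ : SeparableClosure K →+* SeparableClosure K))) (by
    simp only [sepPoint, Over.mk_hom, ← Category.assoc, ← Spec.map_comp, ← CommRingCat.ofHom_comp]
    congr 3
    ext x
    exact congrArg _ (σ.commutes x))

theorem sepHom_one : sepHom a 1 = 𝟙 _ := by
  ext1
  exact Spec.map_id _

theorem sepHom_mul (σ τ : Gal(SeparableClosure K/K)) :
    sepHom a (σ * τ) = sepHom a σ ≫ sepHom a τ := by
  ext1
  exact Spec.map_comp (CommRingCat.ofHom (τ : SeparableClosure K →+* SeparableClosure K))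
    (CommRingCat.ofHom (σ : SeparableClosure K →+* SeparableClosure K))

/-- The representation of `G_K` on the stalk of `F` at `Spec K^sep → Spec K → X`, by functoriality;
it corresponds to the inverse image of `F` on `Spec K`. -/
def galoisRep :
    Representation (PadicAlgCl ℓ) Gal(SeparableClosure K/K) (F.stalk (sepPoint a)) where
  toFun σ := F.stalkEnd (sepPoint a) (fun n => ((F.sheaf n).map (sepHom a σ).op).hom)
    fun n b => (ConcreteCategory.congr_hom ((F.trans n).naturality (sepHom a σ).op) b)
  map_one' := F.stalkEnd_one _ _ _ fun n b => by
    simp [sepHom_one]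
  map_mul' σ τ := F.stalkEnd_mul _ _ _ _ _ _ _ fun n b => by
    simp [sepHom_mul]

end Galois

/-! #### The monodromy representation -/

section Monodromy

variable {Ω : Type u} [Field Ω] (x : Spec (.of Ω) ⟶ X)

/-- The étale covering representing `F_n`, as an object of `Cov(X)`. -/
def covObj (n : ℕ) : Cov X := ⟨F.cov n, F.covering n⟩

/-- The action of `π₁(X, x)` on the fibre at `x` of an étale covering. -/
def move (σ : fundamentalGroup (isCovering X) x) (Y : Cov X) (y : Over.mk x ⟶ Y.obj) :
    Over.mk x ⟶ Y.obj :=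
  σ.hom.app Y y

theorem move_comp (σ : fundamentalGroup (isCovering X) x) {Y Y' : Cov X} (f : Y ⟶ Y')
    (y : Over.mk x ⟶ Y.obj) : move x σ Y' (y ≫ f.hom) = move x σ Y y ≫ f.hom :=
  ConcreteCategory.congr_hom (σ.hom.naturality f) y

/-- The action of `π₁(X, x)` on `F_{n,x}`, through the bijection of `F_{n,x}` with the fibre at `x`
of the étale covering that represents `F_n`. -/
def piAct (σ : fundamentalGroup (isCovering X) x) (n : ℕ) (a : F.sec n (Over.mk x)) :
    F.sec n (Over.mk x) :=
  (F.repr n).homEquiv (move x σ (F.covObj n) ((F.repr n).homEquiv.symm a))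

theorem piAct_of_hom (σ : fundamentalGroup (isCovering X) x) {m : ℕ} {Y : Cov X}
    (f : Y.obj ⟶ F.cov m) (y : Over.mk x ⟶ Y.obj) :
    F.piAct x σ m ((F.repr m).homEquiv (y ≫ f)) =
      (F.repr m).homEquiv ((move x σ Y y) ≫ f) := by
  unfold piAct
  rw [Equiv.symm_apply_apply]
  exact congrArg _ (move_comp x σ (Y' := F.covObj m) (ObjectProperty.homMk f) y)

theorem homEquiv_comp {Y T : Over X} (n : ℕ) (y : T ⟶ Y) (f : Y ⟶ F.cov n) :
    (F.repr n).homEquiv (y ≫ f) = (F.sheaf n).map y.op ((F.repr n).homEquiv f) :=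
  (F.repr n).homEquiv_comp y f

theorem piAct_map (σ : fundamentalGroup (isCovering X) x) {m : ℕ} {Y : Cov X}
    (b : F.sec m Y.obj) (y : Over.mk x ⟶ Y.obj) :
    F.piAct x σ m ((F.sheaf m).map y.op b) =
      (F.sheaf m).map (move x σ Y y).op b := by
  obtain ⟨f, rfl⟩ := (F.repr m).homEquiv.surjective b
  have := F.piAct_of_hom x σ f y
  rw [homEquiv_comp, homEquiv_comp] at this
  exact this

/-- Every element of `F_{n,x}` comes from the tautological section over the covering. -/
theorem exists_map (n : ℕ) (a : F.sec n (Over.mk x)) :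
    ∃ y : Over.mk x ⟶ F.cov n, (F.sheaf n).map y.op ((F.repr n).homEquiv (𝟙 _)) = a :=
  ⟨(F.repr n).homEquiv.symm a, by rw [← homEquiv_comp]; simp⟩

theorem piAct_smul (σ : fundamentalGroup (isCovering X) x) (n : ℕ) (c : IntRing F.E)
    (a : F.sec n (Over.mk x)) : F.piAct x σ n (c • a) = c • F.piAct x σ n a := by
  obtain ⟨y, rfl⟩ := F.exists_map x n a
  have h1 := F.piAct_map x σ (Y := F.covObj n) ((F.repr n).homEquiv (𝟙 _)) y
  have h2 := F.piAct_map x σ (Y := F.covObj n) (c • (F.repr n).homEquiv (𝟙 _)) y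
  refine (congrArg _ (map_smul ((F.sheaf n).map y.op).hom c _).symm).trans (h2.trans ?_)
  refine (map_smul ((F.sheaf n).map (move x σ (F.covObj n) y).op).hom c _).trans ?_
  exact congrArg _ h1.symm

/-- The fibre square of an étale covering. -/
def square (n : ℕ) : Cov X :=
  ⟨Over.mk (pullback.fst (F.cov n).hom (F.cov n).hom ≫ (F.cov n).hom), by
    obtain ⟨_, _⟩ := F.covering n
    exact ⟨inferInstanceAs (IsFinite (_ ≫ _)), inferInstanceAs (Etale (_ ≫ _))⟩⟩

theorem piAct_add (σ : fundamentalGroup (isCovering X) x) (n : ℕ) (a b : F.sec n (Over.mk x)) :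
    F.piAct x σ n (a + b) = F.piAct x σ n a + F.piAct x σ n b := by
  obtain ⟨y, rfl⟩ := F.exists_map x n a
  obtain ⟨z, rfl⟩ := F.exists_map x n b
  let p : (F.square n).obj ⟶ F.cov n := Over.homMk (pullback.fst _ _) rfl
  let q : (F.square n).obj ⟶ F.cov n := Over.homMk (pullback.snd _ _) pullback.condition.symm
  let w : Over.mk x ⟶ (F.square n).obj :=
    Over.homMk (pullback.lift y.left z.left ((Over.w y).trans (Over.w z).symm)) (by
      simp only [square, Over.mk_hom, pullback.lift_fst_assoc]
      exact Over.w y)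
  have hp : w ≫ p = y := by ext1; exact pullback.lift_fst _ _ _
  have hq : w ≫ q = z := by ext1; exact pullback.lift_snd _ _ _
  have key (r : (F.square n).obj ⟶ F.cov n) :
      (F.sheaf n).map w.op ((F.sheaf n).map r.op ((F.repr n).homEquiv (𝟙 _))) =
        (F.sheaf n).map (w ≫ r).op ((F.repr n).homEquiv (𝟙 _)) := by
    simp
  rw [← hp, ← hq, ← key, ← key, ← map_add, piAct_map, piAct_map, piAct_map, map_add]

/-- The action of `π₁(X, x)` on `F_{n,x}` as a linear map. -/
def piLin (σ : fundamentalGroup (isCovering X) x) (n : ℕ) :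
    Module.End (IntRing F.E) (F.sec n (Over.mk x)) where
  toFun := F.piAct x σ n
  map_add' := F.piAct_add x σ n
  map_smul' := F.piAct_smul x σ n

theorem trans_piAct (σ : fundamentalGroup (isCovering X) x) (n : ℕ)
    (a : F.sec (n + 1) (Over.mk x)) :
    (F.trans n).app (op (Over.mk x)) (F.piAct x σ (n + 1) a) =
      F.piAct x σ n ((F.trans n).app (op (Over.mk x)) a) := by
  obtain ⟨y, rfl⟩ := F.exists_map x (n + 1) a
  have nat {T : Over X} (t : T ⟶ F.cov (n + 1)) :
      (F.trans n).app (op T) ((F.sheaf (n + 1)).map t.op ((F.repr (n + 1)).homEquiv (𝟙 _))) =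
        (F.sheaf n).map t.op ((F.trans n).app _ ((F.repr (n + 1)).homEquiv (𝟙 _))) :=
    ConcreteCategory.congr_hom ((F.trans n).naturality t.op) _
  rw [nat]
  have h1 := F.piAct_map x σ (Y := F.covObj (n + 1)) ((F.repr (n + 1)).homEquiv (𝟙 _)) y
  have h2 := F.piAct_map x σ (Y := F.covObj (n + 1))
    ((F.trans n).app _ ((F.repr (n + 1)).homEquiv (𝟙 _))) y
  refine Eq.trans ?_ h2.symm
  refine (congrArg _ h1).trans ?_
  exact nat _

/-- The monodromy representation of `π₁(X, x)` on the stalk of `F` at the geometric point `x`. -/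
def monodromy :
    Representation (PadicAlgCl ℓ) (fundamentalGroup (isCovering X) x) (F.stalk (Over.mk x)) where
  toFun σ := F.stalkEnd _ (F.piLin x σ) (F.trans_piAct x σ)
  map_one' := F.stalkEnd_one _ _ _ fun n a => by
    change (F.repr n).homEquiv ((F.repr n).homEquiv.symm a) = a
    simp
  map_mul' σ τ := F.stalkEnd_mul _ _ _ _ _ _ _ fun n a => by
    change (F.repr n).homEquiv _ = (F.repr n).homEquiv _
    congr 1
    exact congrArg (move x σ (F.covObj n)) ((F.repr n).homEquiv.symm_apply_apply _).symm

end Monodromy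

/-! #### Rank, factorization of the monodromy, and the Swan conductor -/

/-- `F` has rank `r`: its stalk at the geometric point `x` has dimension `r`. -/
def HasRank {Ω : Type u} [Field Ω] (x : Spec (.of Ω) ⟶ X) (r : ℕ) : Prop :=
  Module.rank (PadicAlgCl ℓ) (F.stalk (Over.mk x)) = r

variable {k : Type u} [Field k] {s : X ⟶ Spec (.of k)} [IsVariety s] {Xb : Compactification s}

/-- The monodromy representation of `F` at `x` factors through `π₁(X, x) → π₁(X, D, x)`. -/
def FactorsThrough {Ω : Type u} [Field Ω] (x : Spec (.of Ω) ⟶ X) (D : BoundaryDivisor Xb) : Prop :=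
  ∃ ρ : Representation (PadicAlgCl ℓ) (fundamentalGroup (isBoundedCovering D) x)
      (F.stalk (Over.mk x)),
    F.monodromy x = ρ.comp (restrictHom (isBoundedCovering_le D) x)

/-- The Swan conductor of `φ^* F` at the point at infinity `z` of `C`: the Swan conductor of the
Galois representation defined by the inverse image of `F` on `Spec k(C)_z`. -/
def swanAt (P : PointAtInfinity Xb) : ℝ≥0∞ :=
  swan P.O (F.galoisRep P.toX)

/-- `Sw(F) ≤ D`: for every `φ : C → X` in `Cu(X)`, the inequality `Sw(φ^* F) ≤ φ̄^* D` of divisors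
on `C̄` with support in `C̄ ∖ C`. -/
def SwanLE (D : BoundaryDivisor Xb) : Prop :=
  ∀ P : PointAtInfinity Xb, F.swanAt P ≤ (P.mult D : ℝ≥0∞)

end SmoothSheaf

end SwanBound

end

/-! Fix a point at infinity `z` of a curve `C`. Let `K` be the local field there and `m` the
multiplicity of the pullback of `D`. The bound reduces to one claim: `G_K^{m+}` acts trivially on
the stalk of `F` at `Spec K^sep → X`. Given this, no break of the representation exceeds `m`. The
dimensions of the break quotients add up to at most `r`, so the Swan conductor is at most `m * r`
(`swan_le`), and this is the multiplicity of the pullback of `rD` (`PointAtInfinity.mult_smul`).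

For the claim, `X` is connected, so a path `e` joins the fibre functor at `x` to the one at `Spec
K^sep → X` (`nonempty_fibre_iso`). The group `G_K` acts on the second functor, and conjugation by
`e` carries this action into `π₁(X, x)`. The stalk depends functorially on the fibre functor, so the
Galois representation is conjugate to the monodromy of the resulting elements
(`galoisRep_eq_conj_monodromy`).

A `K^sep`-point of a covering bounded by `D` is an embedding of one of its local extensions of `K`,
hence is fixed by `G_K^{m+}`. Elements of `G_K^{m+}` therefore become trivial in `π₁(X, D, x)`,
through which the monodromy factors. -/

noncomputable section

namespace SwanBound

/-! ### Breaks of a Galois representation and its Swan conductor -/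

section Ramification

variable {K : Type u} [Field K] (A : ValuationSubring K)

theorem absUpperGroup_le_absUpperGroupPlus {lam mu : ℝ} (h : lam < mu) :
    absUpperGroup A mu ≤ absUpperGroupPlus A lam :=
  (le_iSup₂ (f := fun mu (_ : lam < mu) => absUpperGroup A mu) mu h).trans
    (Subgroup.le_topologicalClosure _)

theorem absUpperGroupPlus_anti : Antitone (absUpperGroupPlus A) := fun _ _ h =>
  Subgroup.topologicalClosure_mono
    (iSup₂_le fun mu hmu => le_iSup₂_of_le mu (h.trans_lt hmu) le_rfl)

variable {F : Type} [Field F] {V : Type u} [AddCommGroup V] [Module F V]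

theorem mem_fixedBy {G : Type u} [Group G] {ρ : Representation F G V} {H : Subgroup G} {v : V} :
    v ∈ fixedBy ρ H ↔ ∀ g ∈ H, ρ g v = v := by
  simp [fixedBy, Representation.mem_invariants]

theorem fixedBy_anti {G : Type u} [Group G] (ρ : Representation F G V) {H H' : Subgroup G}
    (h : H ≤ H') : fixedBy ρ H' ≤ fixedBy ρ H := fun _ hv =>
  mem_fixedBy.2 fun g hg => mem_fixedBy.1 hv g (h hg)

/-- The dimension of the break of `V` at `λ`. -/
def breakDim (ρ : Representation F Gal(SeparableClosure K/K) V) (lam : ℝ) : ℕ :=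
  Module.finrank F (fixedBy ρ (absUpperGroupPlus A lam) ⧸
      (fixedBy ρ (absUpperGroup A lam)).submoduleOf (fixedBy ρ (absUpperGroupPlus A lam)))

variable {A} in
theorem breakDim_eq_zero {ρ : Representation F Gal(SeparableClosure K/K) V} {lam mu : ℝ}
    (h : ∀ σ ∈ absUpperGroupPlus A mu, ρ σ = 1) (hlam : mu < lam) : breakDim A ρ lam = 0 := by
  -- `G^λ` lies in `G^{μ+}`, so it fixes all of `V` and the quotient at `λ` vanishes.
  have htop : fixedBy ρ (absUpperGroup A lam) = ⊤ := eq_top_iff.2 fun v _ =>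
    mem_fixedBy.2 fun g hg => by
      rw [h g (absUpperGroup_le_absUpperGroupPlus A hlam hg)]; rfl
  rw [breakDim, htop, Submodule.submoduleOf, Submodule.comap_top]
  exact Module.finrank_zero_of_subsingleton

/-- The break quotients are successive quotients of an increasing chain of fixed spaces, so their
dimensions telescope. Removing the largest index `a` leaves indices whose fixed spaces all lie in
the submodule divided out at `a`. Only `G^μ ≤ G^{λ+}` for `λ < μ` and the monotonicity of `G^{λ+}`
are needed. The inclusion of `G^{λ+}` in `G^λ` is avoided by intersecting `T` with `U`. -/
theorem sum_breakDim_le [FiniteDimensional F V]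
    (ρ : Representation F Gal(SeparableClosure K/K) V) (s : Finset ℝ) (W : Submodule F V)
    (hW : ∀ lam ∈ s, fixedBy ρ (absUpperGroupPlus A lam) ≤ W) :
    ∑ lam ∈ s, breakDim A ρ lam ≤ Module.finrank F W := by
  induction s using Finset.induction_on_max generalizing W with
  | empty => simp
  | insert a s hs ih =>
    rw [Finset.sum_insert fun h => lt_irrefl a (hs a h)]
    set U := fixedBy ρ (absUpperGroupPlus A a)
    set T := fixedBy ρ (absUpperGroup A a)
    have h1 := ih (T ⊓ U) fun lam hlam => le_inf
      (fixedBy_anti ρ (absUpperGroup_le_absUpperGroupPlus A (hs lam hlam)))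
      (fixedBy_anti ρ (absUpperGroupPlus_anti A (hs lam hlam).le))
    have h2 : Module.finrank F (T.submoduleOf U) = Module.finrank F (T ⊓ U : Submodule F V) := by
      rw [← Submodule.finrank_map_subtype_eq U (T.submoduleOf U), Submodule.submoduleOf,
        Submodule.map_comap_subtype, inf_comm]
    have h3 : breakDim A ρ a + Module.finrank F (T.submoduleOf U) = Module.finrank F U :=
      Submodule.finrank_quotient_add_finrank _
    have h4 : Module.finrank F U ≤ Module.finrank F W :=
      Submodule.finrank_mono (hW a (Finset.mem_insert_self a s))
    omega

theorem swan_le [FiniteDimensional F V] (ρ : Representation F Gal(SeparableClosure K/K) V) (m : ℕ)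
    (h : ∀ σ ∈ absUpperGroupPlus A m, ρ σ = 1) :
    swan A ρ ≤ m * Module.finrank F V := by
  -- Either the weight `λ` is at most `m`, or the break at `λ` is zero.
  have hterm (lam : ℝ) :
      ENNReal.ofReal lam * (breakDim A ρ lam : ℝ≥0∞) ≤ m * (breakDim A ρ lam : ℝ≥0∞) := by
    rcases le_or_gt lam m with hl | hl
    · exact mul_le_mul_left (ENNReal.ofReal_le_natCast.2 hl) _
    · simp [breakDim_eq_zero h hl]
  -- The sum runs over all positive reals; it is the supremum of its finite partial sums, each
  -- bounded by `sum_breakDim_le` with `W = ⊤`.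
  rw [swan, ENNReal.tsum_eq_iSup_sum]
  refine iSup_le fun s => ?_
  refine (Finset.sum_le_sum fun lam _ => hterm lam.1).trans ?_
  rw [← Finset.mul_sum]
  refine mul_le_mul_right ?_ _
  have := sum_breakDim_le A ρ (s.map (Function.Embedding.subtype _)) ⊤ fun _ _ => le_top
  rw [Finset.sum_map, finrank_top] at this
  exact_mod_cast this

end Ramification

/-! ### Multiplicities of powers of an ideal sheaf -/

section Order

theorem idealOrder_maximalIdeal_pow {R : Type u} [CommRing R] [IsDomain R]
    [IsDiscreteValuationRing R] (n : ℕ) : idealOrder (IsLocalRing.maximalIdeal R ^ n) = n := by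
  have : {j : ℕ | IsLocalRing.maximalIdeal R ^ n ≤ IsLocalRing.maximalIdeal R ^ j} = Set.Iic n := by
    ext j
    exact (Ideal.pow_right_strictAnti _ (IsDiscreteValuationRing.not_a_field R)
      (Ideal.IsPrime.ne_top inferInstance)).le_iff_ge
  rw [idealOrder, this, csSup_Iic]

/-- Every power of the maximal ideal contains `0`, so the set of exponents is unbounded and `sSup`
in `ℕ` takes its default value `0`. -/
theorem idealOrder_bot {R : Type u} [CommRing R] [IsLocalRing R] :
    idealOrder (⊥ : Ideal R) = 0 := by
  simp [idealOrder]

/-- A nonzero ideal is a power of the maximal ideal. With the default value for `⊥` the formula also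
holds for the zero ideal, so it is not necessary to know that the pullback of `D` is nonzero. -/
theorem idealOrder_pow {R : Type u} [CommRing R] [IsDomain R] [IsDiscreteValuationRing R]
    (J : Ideal R) (r : ℕ) : idealOrder (J ^ r) = r * idealOrder J := by
  rcases eq_or_ne J ⊥ with rfl | hJ
  · rcases Nat.eq_zero_or_pos r with rfl | hr
    · simpa using idealOrder_maximalIdeal_pow (R := R) 0
    · rw [Ideal.bot_pow hr.ne', idealOrder_bot, mul_zero]
  · obtain ⟨n, rfl⟩ := exists_maximalIdeal_pow_eq_of_principal R inferInstance J hJ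
    rw [← pow_mul, idealOrder_maximalIdeal_pow, idealOrder_maximalIdeal_pow, mul_comm]

theorem map_germ_ideal_eq {X : Scheme.{u}} (I : X.IdealSheafData) {x : X} {U V : X.affineOpens}
    (h : U ≤ V) (hx : x ∈ U.1) :
    (I.ideal U).map (X.presheaf.germ U.1 x hx).hom =
      (I.ideal V).map (X.presheaf.germ V.1 x (h hx)).hom := by
  have h1 : (X.presheaf.germ U.1 x hx).hom.comp (X.presheaf.map (homOfLE h).op).hom =
      (X.presheaf.germ V.1 x (h hx)).hom :=
    RingHom.ext fun c => X.presheaf.germ_res_apply (homOfLE h) x hx c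
  rw [← I.map_ideal h, Ideal.map_map, h1]

/-- All affine neighbourhoods of `x` generate the same ideal of the stalk: two of them are compared
through a third contained in their intersection. The supremum is thus computed on any single one. -/
theorem stalkIdeal_eq {X : Scheme.{u}} (I : X.IdealSheafData) {x : X} {U : X.affineOpens}
    (hx : x ∈ U.1) : stalkIdeal I x = (I.ideal U).map (X.presheaf.germ U.1 x hx).hom := by
  refine le_antisymm (iSup₂_le fun V hV => ?_) (le_iSup₂_of_le U hx le_rfl)
  obtain ⟨_, ⟨W, hW, rfl⟩, hxW, hWUV⟩ :=
    X.isBasis_affineOpens.exists_subset_of_mem_open (⟨hx, hV⟩ : x ∈ (U.1 ⊓ V.1 : X.Opens))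
      (U.1 ⊓ V.1 : X.Opens).isOpen
  have hU : (⟨W, hW⟩ : X.affineOpens) ≤ U := fun _ h => (hWUV h).1
  have hV' : (⟨W, hW⟩ : X.affineOpens) ≤ V := fun _ h => (hWUV h).2
  exact ((map_germ_ideal_eq I hV' hxW).symm.trans (map_germ_ideal_eq I hU hxW)).le

theorem stalkIdeal_pow {X : Scheme.{u}} (I : X.IdealSheafData) (x : X) (r : ℕ) :
    stalkIdeal (I ^ r) x = stalkIdeal I x ^ r := by
  obtain ⟨_, ⟨U, hU, rfl⟩, hx, -⟩ :=
    X.isBasis_affineOpens.exists_subset_of_mem_open (Set.mem_univ x) isOpen_univ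
  rw [stalkIdeal_eq (U := ⟨U, hU⟩) _ hx, stalkIdeal_eq (U := ⟨U, hU⟩) _ hx,
    Scheme.IdealSheafData.ideal_pow, Pi.pow_apply, Ideal.map_pow]

theorem PointAtInfinity.mult_smul {k : Type u} [Field k] {X : Scheme.{u}} {s : X ⟶ Spec (.of k)}
    [IsVariety s] {Xb : Compactification s} (P : PointAtInfinity Xb) (r : ℕ)
    (D : BoundaryDivisor Xb) : P.mult (D.smul r) = r * P.mult D := by
  simp only [mult, BoundaryDivisor.smul, stalkIdeal_pow, Ideal.map_pow, idealOrder_pow]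

end Order

namespace SmoothSheaf

/-! #### Functoriality of stalks in the fibre functor -/

section Transport

variable {ℓ : ℕ} [Fact ℓ.Prime] {X : Scheme.{u}} (F : SmoothSheaf ℓ X)

variable {Ω Ω' Ω'' : Type u} [Field Ω] [Field Ω'] [Field Ω'']
  {x : Spec (.of Ω) ⟶ X} {x' : Spec (.of Ω') ⟶ X} {x'' : Spec (.of Ω'') ⟶ X}

/-- The map `F_{n,x} → F_{n,x'}` induced by a natural transformation of fibre functors. -/
def transport (α : fibre (isCovering X) x ⟶ fibre (isCovering X) x') (n : ℕ)
    (a : F.sec n (Over.mk x)) : F.sec n (Over.mk x') :=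
  (F.repr n).homEquiv (α.app (F.covObj n) ((F.repr n).homEquiv.symm a))

/-- This is naturality of `α` along the morphism `Y ⟶ F.cov m` that represents `b`. It yields
linearity and compatibility with `trans`: stalk elements are pulled back from sections over a
covering, where each operation can be done before transporting. -/
theorem transport_map (α : fibre (isCovering X) x ⟶ fibre (isCovering X) x') {m : ℕ} {Y : Cov X}
    (b : F.sec m Y.obj) (y : Over.mk x ⟶ Y.obj) :
    F.transport α m ((F.sheaf m).map y.op b) = (F.sheaf m).map (Quiver.Hom.op (α.app Y y)) b := by
  obtain ⟨f, rfl⟩ := (F.repr m).homEquiv.surjective b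
  rw [← homEquiv_comp, transport, Equiv.symm_apply_apply]
  refine (congrArg (F.repr m).homEquiv ?_).trans (homEquiv_comp F m _ f)
  exact ConcreteCategory.congr_hom
    (α.naturality (Y := F.covObj m) (ObjectProperty.homMk f)) y

theorem transport_smul (α : fibre (isCovering X) x ⟶ fibre (isCovering X) x') (n : ℕ)
    (c : IntRing F.E) (a : F.sec n (Over.mk x)) :
    F.transport α n (c • a) = c • F.transport α n a := by
  obtain ⟨y, rfl⟩ := F.exists_map x n a
  have h1 := F.transport_map α (Y := F.covObj n) ((F.repr n).homEquiv (𝟙 _)) y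
  have h2 := F.transport_map α (Y := F.covObj n) (c • (F.repr n).homEquiv (𝟙 _)) y
  refine (congrArg _ (map_smul ((F.sheaf n).map y.op).hom c _).symm).trans (h2.trans ?_)
  refine (map_smul ((F.sheaf n).map (Quiver.Hom.op (α.app (F.covObj n) y))).hom c _).trans ?_
  exact congrArg _ h1.symm

theorem transport_add (α : fibre (isCovering X) x ⟶ fibre (isCovering X) x') (n : ℕ)
    (a b : F.sec n (Over.mk x)) :
    F.transport α n (a + b) = F.transport α n a + F.transport α n b := by
  obtain ⟨y, rfl⟩ := F.exists_map x n a
  obtain ⟨z, rfl⟩ := F.exists_map x n b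
  -- The two tautological sections can be added over the fibre square of the covering; `w` is the
  -- point of the square with coordinates `y` and `z`.
  let p : (F.square n).obj ⟶ F.cov n := Over.homMk (pullback.fst _ _) rfl
  let q : (F.square n).obj ⟶ F.cov n := Over.homMk (pullback.snd _ _) pullback.condition.symm
  let w : Over.mk x ⟶ (F.square n).obj :=
    Over.homMk (pullback.lift y.left z.left ((Over.w y).trans (Over.w z).symm)) (by
      simp only [square, Over.mk_hom, pullback.lift_fst_assoc]
      exact Over.w y)
  have hp : w ≫ p = y := by ext1; exact pullback.lift_fst _ _ _
  have hq : w ≫ q = z := by ext1; exact pullback.lift_snd _ _ _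
  have key (r : (F.square n).obj ⟶ F.cov n) :
      (F.sheaf n).map w.op ((F.sheaf n).map r.op ((F.repr n).homEquiv (𝟙 _))) =
        (F.sheaf n).map (w ≫ r).op ((F.repr n).homEquiv (𝟙 _)) := by
    simp
  rw [← hp, ← hq, ← key, ← key, ← map_add, transport_map, transport_map, transport_map, map_add]

theorem trans_transport (α : fibre (isCovering X) x ⟶ fibre (isCovering X) x') (n : ℕ)
    (a : F.sec (n + 1) (Over.mk x)) :
    (F.trans n).app (op (Over.mk x')) (F.transport α (n + 1) a) =
      F.transport α n ((F.trans n).app (op (Over.mk x)) a) := by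
  obtain ⟨y, rfl⟩ := F.exists_map x (n + 1) a
  have nat {T : Over X} (t : T ⟶ F.cov (n + 1)) :
      (F.trans n).app (op T) ((F.sheaf (n + 1)).map t.op ((F.repr (n + 1)).homEquiv (𝟙 _))) =
        (F.sheaf n).map t.op ((F.trans n).app _ ((F.repr (n + 1)).homEquiv (𝟙 _))) :=
    ConcreteCategory.congr_hom ((F.trans n).naturality t.op) _
  rw [nat]
  have h1 := F.transport_map α (Y := F.covObj (n + 1)) ((F.repr (n + 1)).homEquiv (𝟙 _)) y
  have h2 := F.transport_map α (Y := F.covObj (n + 1))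
    ((F.trans n).app _ ((F.repr (n + 1)).homEquiv (𝟙 _))) y
  refine Eq.trans ?_ h2.symm
  refine (congrArg _ h1).trans ?_
  exact nat _

/-- The linear map `lim_n F_{n,x} → lim_n F_{n,x'}` induced by a natural transformation of fibre
functors. -/
def latticeMap (α : fibre (isCovering X) x ⟶ fibre (isCovering X) x') :
    F.lattice (Over.mk x) →ₗ[IntRing F.E] F.lattice (Over.mk x') where
  toFun a := ⟨fun n => F.transport α n (a.1 n), fun n => by rw [trans_transport, a.2 n]⟩
  map_add' a b := Subtype.ext (funext fun n => F.transport_add α n (a.1 n) (b.1 n))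
  map_smul' c a := Subtype.ext (funext fun n => F.transport_smul α n c (a.1 n))

/-- The linear map of stalks `F_x → F_{x'}` induced by a natural transformation of fibre
functors. -/
def stalkMap (α : fibre (isCovering X) x ⟶ fibre (isCovering X) x') :
    F.stalk (Over.mk x) →ₗ[PadicAlgCl ℓ] F.stalk (Over.mk x') :=
  (F.latticeMap α).baseChange (PadicAlgCl ℓ)

theorem stalkMap_id : F.stalkMap (𝟙 (fibre (isCovering X) x)) = LinearMap.id := by
  have : F.latticeMap (𝟙 (fibre (isCovering X) x)) = LinearMap.id :=
    LinearMap.ext fun a => Subtype.ext (funext fun n => (F.repr n).homEquiv.apply_symm_apply _)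
  rw [stalkMap, this, LinearMap.baseChange_id]

theorem stalkMap_comp (α : fibre (isCovering X) x ⟶ fibre (isCovering X) x')
    (β : fibre (isCovering X) x' ⟶ fibre (isCovering X) x'') :
    F.stalkMap (α ≫ β) = F.stalkMap β ∘ₗ F.stalkMap α := by
  have : F.latticeMap (α ≫ β) = F.latticeMap β ∘ₗ F.latticeMap α :=
    LinearMap.ext fun a => Subtype.ext (funext fun n => congrArg (F.repr n).homEquiv
      (congrArg (β.app (F.covObj n)) ((F.repr n).homEquiv.symm_apply_apply _).symm))
  rw [stalkMap, this, LinearMap.baseChange_comp]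
  rfl

/-- An isomorphism of fibre functors induces an isomorphism of stalks. -/
def stalkEquiv (e : fibre (isCovering X) x ≅ fibre (isCovering X) x') :
    F.stalk (Over.mk x) ≃ₗ[PadicAlgCl ℓ] F.stalk (Over.mk x') :=
  LinearEquiv.ofLinearMap (F.stalkMap e.hom) (F.stalkMap e.inv)
    (by rw [← stalkMap_comp, e.inv_hom_id, stalkMap_id])
    (by rw [← stalkMap_comp, e.hom_inv_id, stalkMap_id])

theorem monodromy_eq_stalkMap (σ : fundamentalGroup (isCovering X) x) :
    F.monodromy x σ = F.stalkMap σ.hom :=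
  rfl

end Transport

end SmoothSheaf

/-! ### Galois action on the fibre functor at a separable closure -/

/-- The endomorphism of a fibre functor given by an endomorphism of the geometric point. -/
def precomp {X : Scheme.{u}} (P : ObjectProperty (Over X)) {Ω : Type u} [Field Ω]
    {x : Spec (.of Ω) ⟶ X} (h : Over.mk x ⟶ Over.mk x) : fibre P x ⟶ fibre P x :=
  Functor.whiskerLeft P.ι (coyoneda.map h.op)

/-- The geometric point `Spec K^sep → Spec K → X`, as a morphism. -/
abbrev sepPointHom {X : Scheme.{u}} {K : Type u} [Field K] (a : Spec (.of K) ⟶ X) :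
    Spec (.of (SeparableClosure K)) ⟶ X :=
  Spec.map (CommRingCat.ofHom (algebraMap K (SeparableClosure K))) ≫ a

/-- The action of the Galois group of `K` on the fibre functor at `Spec K^sep → Spec K → X`. -/
def galoisAction {X : Scheme.{u}} (P : ObjectProperty (Over X)) {K : Type u} [Field K]
    (a : Spec (.of K) ⟶ X) (σ : Gal(SeparableClosure K/K)) :
    fibre P (sepPointHom a) ⟶ fibre P (sepPointHom a) :=
  precomp P (SmoothSheaf.sepHom a σ)

theorem galoisAction_one {X : Scheme.{u}} (P : ObjectProperty (Over X)) {K : Type u} [Field K]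
    (a : Spec (.of K) ⟶ X) : galoisAction P a 1 = 𝟙 _ := by
  ext Y y
  change SmoothSheaf.sepHom a 1 ≫ y = y
  rw [SmoothSheaf.sepHom_one]
  exact Category.id_comp y

theorem galoisAction_mul {X : Scheme.{u}} (P : ObjectProperty (Over X)) {K : Type u} [Field K]
    (a : Spec (.of K) ⟶ X) (σ τ : Gal(SeparableClosure K/K)) :
    galoisAction P a (σ * τ) = galoisAction P a τ ≫ galoisAction P a σ := by
  ext Y y
  change SmoothSheaf.sepHom a (σ * τ) ≫ y = SmoothSheaf.sepHom a σ ≫ SmoothSheaf.sepHom a τ ≫ y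
  rw [SmoothSheaf.sepHom_mul]
  exact Category.assoc _ _ _

/-- The action of the Galois group of `K` on the fibre functor, by automorphisms. -/
def galoisIso {X : Scheme.{u}} (P : ObjectProperty (Over X)) {K : Type u} [Field K]
    (a : Spec (.of K) ⟶ X) (σ : Gal(SeparableClosure K/K)) :
    fibre P (sepPointHom a) ≅ fibre P (sepPointHom a) where
  hom := galoisAction P a σ
  inv := galoisAction P a σ⁻¹
  hom_inv_id := by rw [← galoisAction_mul, inv_mul_cancel, galoisAction_one]
  inv_hom_id := by rw [← galoisAction_mul, mul_inv_cancel, galoisAction_one]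

/-- The element of `π₁(X, x)` given by an element of the Galois group of `K` and a path `e`. -/
def galoisConj {X : Scheme.{u}} {P : ObjectProperty (Over X)} {Ω : Type u} [Field Ω]
    {x : Spec (.of Ω) ⟶ X} {K : Type u} [Field K] {a : Spec (.of K) ⟶ X}
    (e : fibre P x ≅ fibre P (sepPointHom a)) (σ : Gal(SeparableClosure K/K)) :
    fundamentalGroup P x :=
  e ≪≫ galoisIso P a σ ≪≫ e.symm

namespace SmoothSheaf

variable {ℓ : ℕ} [Fact ℓ.Prime] {X : Scheme.{u}} (F : SmoothSheaf ℓ X)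

theorem galoisRep_eq_stalkMap {K : Type u} [Field K] (a : Spec (.of K) ⟶ X)
    (σ : Gal(SeparableClosure K/K)) :
    F.galoisRep a σ = F.stalkMap (galoisAction (isCovering X) a σ) := by
  have : F.latticeEnd (sepPoint a) (fun n => ((F.sheaf n).map (sepHom a σ).op).hom)
      (fun n b => (ConcreteCategory.congr_hom ((F.trans n).naturality (sepHom a σ).op) b)) =
      F.latticeMap (galoisAction (isCovering X) a σ) :=
    LinearMap.ext fun b => Subtype.ext (funext fun n => by
      change (F.sheaf n).map (sepHom a σ).op (b.1 n) =
        (F.repr n).homEquiv (sepHom a σ ≫ (F.repr n).homEquiv.symm (b.1 n))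
      rw [homEquiv_comp, Equiv.apply_symm_apply])
  change LinearMap.baseChange _ _ = LinearMap.baseChange _ _
  rw [this]

/-- Both sides are `stalkMap` of natural transformations, and `stalkMap` is functorial; the path `e`
cancels against its inverse. -/
theorem galoisRep_eq_conj_monodromy {Ω : Type u} [Field Ω] {x : Spec (.of Ω) ⟶ X}
    {K : Type u} [Field K] (a : Spec (.of K) ⟶ X)
    (e : fibre (isCovering X) x ≅ fibre (isCovering X) (sepPointHom a))
    (σ : Gal(SeparableClosure K/K)) :
    F.galoisRep a σ = F.stalkMap e.hom ∘ₗ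
      F.monodromy x (galoisConj e σ) ∘ₗ F.stalkMap e.inv := by
  rw [monodromy_eq_stalkMap, ← stalkMap_comp, ← stalkMap_comp, galoisRep_eq_stalkMap]
  congr 1
  simp [galoisConj, galoisIso]

end SmoothSheaf

/-! ### Existence of paths between geometric points -/

section Path

variable {X : Scheme.{u}}

theorem isCovering_comp {Y : Over X} (hY : isCovering X Y) {Z : Scheme.{u}} (f : Z ⟶ Y.left)
    [IsFinite f] [Etale f] : isCovering X (Over.mk (f ≫ Y.hom)) := by
  obtain ⟨_, _⟩ := hY
  exact ⟨inferInstanceAs (IsFinite (_ ≫ _)), inferInstanceAs (Etale (_ ≫ _))⟩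

theorem isCovering_pullback {Y Z : Over X} (hY : isCovering X Y) (hZ : isCovering X Z) :
    isCovering X (Over.mk (pullback.fst Y.hom Z.hom ≫ Y.hom)) := by
  obtain ⟨_, _⟩ := hZ
  exact isCovering_comp hY _

/-- The point of a fibre product defined by two points of the factors. -/
def pairing {T Y Z : Over X} (a : T ⟶ Y) (b : T ⟶ Z) :
    T ⟶ Over.mk (pullback.fst Y.hom Z.hom ≫ Y.hom) :=
  Over.homMk (pullback.lift a.left b.left ((Over.w a).trans (Over.w b).symm)) (by
    simp only [Over.mk_hom, pullback.lift_fst_assoc]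
    exact Over.w a)

/-- The first projection of a fibre product. -/
def projFst (Y Z : Over X) : Over.mk (pullback.fst Y.hom Z.hom ≫ Y.hom) ⟶ Y :=
  Over.homMk (pullback.fst _ _) rfl

/-- The second projection of a fibre product. -/
def projSnd (Y Z : Over X) : Over.mk (pullback.fst Y.hom Z.hom ≫ Y.hom) ⟶ Z :=
  Over.homMk (pullback.snd _ _) pullback.condition.symm

theorem pairing_fst {T Y Z : Over X} (a : T ⟶ Y) (b : T ⟶ Z) :
    pairing a b ≫ projFst Y Z = a := by
  ext1; exact pullback.lift_fst _ _ _

theorem pairing_snd {T Y Z : Over X} (a : T ⟶ Y) (b : T ⟶ Z) :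
    pairing a b ≫ projSnd Y Z = b := by
  ext1; exact pullback.lift_snd _ _ _

/-- A finite étale map is closed and open, so its image is all of the connected `X`. A point above
`x` then lifts to an `Ω`-point because `Ω` is separably closed. -/
theorem exists_point [ConnectedSpace X] {Y : Over X} (hY : isCovering X Y) [Nonempty Y.left]
    {Ω : Type u} [Field Ω] [IsSepClosed Ω] (x : Spec (.of Ω) ⟶ X) :
    Nonempty (Over.mk x ⟶ Y) := by
  obtain ⟨_, _⟩ := hY
  have hclopen : IsClopen (Set.range Y.hom) :=
    ⟨Y.hom.isClosedMap.isClosed_range, Y.hom.isOpenMap.isOpen_range⟩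
  have hsurj : Set.range Y.hom = Set.univ := hclopen.eq_univ (Set.range_nonempty _)
  obtain ⟨y, hy⟩ : x default ∈ Set.range Y.hom := hsurj ▸ Set.mem_univ _
  obtain ⟨l, hl, -⟩ := Scheme.exists_fac_of_etale_of_isSepClosed Y.hom x y hy
  exact ⟨Over.homMk l hl⟩

/-- Points of `Y` above `x` are sections of the pullback of `Y` to `Spec Ω`. This is the spectrum of
a finite `Ω`-algebra `R`, which has finitely many algebra maps to `Ω`. -/
theorem finite_points {Y : Over X} (hY : isCovering X Y) {Ω : Type u} [Field Ω]
    (x : Spec (.of Ω) ⟶ X) : Finite (Over.mk x ⟶ Y) := by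
  obtain ⟨_, _⟩ := hY
  have : IsAffine (pullback x Y.hom) := isAffine_of_isAffineHom (pullback.fst x Y.hom)
  let i := (pullback x Y.hom).isoSpec
  let R := Γ(pullback x Y.hom, ⊤)
  obtain ⟨f, hf⟩ := Spec.map_surjective (i.inv ≫ pullback.fst x Y.hom)
  have hfin : f.hom.Finite := by
    rw [← IsFinite.SpecMap_iff, hf]
    infer_instance
  algebraize [f.hom]
  let g' (a : Over.mk x ⟶ Y) : Spec (.of Ω) ⟶ pullback x Y.hom :=
    pullback.lift (𝟙 _) a.left (by rw [Category.id_comp]; exact (Over.w a).symm)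
  have hfst (a : Over.mk x ⟶ Y) : g' a ≫ pullback.fst x Y.hom = 𝟙 _ := pullback.lift_fst _ _ _
  have hsnd (a : Over.mk x ⟶ Y) : g' a ≫ pullback.snd x Y.hom = a.left := pullback.lift_snd _ _ _
  let g (a : Over.mk x ⟶ Y) : Spec (.of Ω) ⟶ Spec R := g' a ≫ i.hom
  have hg (a : Over.mk x ⟶ Y) : g a ≫ Spec.map f = 𝟙 _ := by
    simp [g, hf, hfst]
  let h (a : Over.mk x ⟶ Y) : R →ₐ[Ω] Ω :=
    { (Spec.preimage (g a)).hom with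
      commutes' := fun c => by
        have : f ≫ Spec.preimage (g a) = 𝟙 _ := Spec.map_injective (by simp [hg])
        exact ConcreteCategory.congr_hom this c }
  have : Finite (R →ₐ[Ω] Ω) := inferInstance
  refine Finite.of_injective h fun a b hab => ?_
  have h1 : Spec.preimage (g a) = Spec.preimage (g b) := by
    ext c
    exact DFunLike.congr_fun hab c
  have h2 : g a = g b := by rw [← Spec.map_preimage (g a), h1, Spec.map_preimage]
  have h3 := congrArg (fun q => q ≫ i.inv ≫ pullback.snd x Y.hom) h2
  ext1
  simpa [g, hsnd] using h3

variable {Ω Ω' : Type u} [Field Ω] [Field Ω']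
  {x : Spec (.of Ω) ⟶ X} {x' : Spec (.of Ω') ⟶ X}

/-- A covering that classifies the pairs of distinct points of a covering. -/
theorem exists_offDiagonal {Y : Over X} (hY : isCovering X Y) :
    ∃ (W : Cov X) (p q : W.obj ⟶ Y), (∀ {Ω : Type u} [Field Ω] (x : Spec (.of Ω) ⟶ X)
      (a b : Over.mk x ⟶ Y), a ≠ b → ∃ w : Over.mk x ⟶ W.obj, w ≫ p = a ∧ w ≫ q = b) ∧
      ∀ {Ω : Type u} [Field Ω] (x : Spec (.of Ω) ⟶ X) (w : Over.mk x ⟶ W.obj), w ≫ p ≠ w ≫ q := by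
  obtain ⟨_, _⟩ := id hY
  -- The diagonal is closed since `Y` is separated over `X`, and open since `Y` is étale. Its
  -- complement is open and closed in `Y ×_X Y`, hence again a covering.
  let Δ := pullback.diagonal Y.hom
  let U : (pullback Y.hom Y.hom).Opens :=
    ⟨(Set.range Δ)ᶜ, Δ.isClosedEmbedding.isClosed_range.isOpen_compl⟩
  have : IsClosedImmersion U.ι := .of_isPreimmersion _ (by
    rw [Scheme.Opens.range_ι]
    exact (Δ.isOpenEmbedding.isOpen_range).isClosed_compl)
  let ι : Over.mk (U.ι ≫ pullback.fst Y.hom Y.hom ≫ Y.hom) ⟶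
      Over.mk (pullback.fst Y.hom Y.hom ≫ Y.hom) := Over.homMk U.ι
  refine ⟨⟨_, isCovering_comp (isCovering_pullback hY hY) U.ι⟩, ι ≫ projFst Y Y, ι ≫ projSnd Y Y,
    fun {Ω _} x a b hab => ?_, fun {Ω _} x w hw => ?_⟩
  · have hr : Set.range (pairing a b).left ⊆ Set.range U.ι := by
      rw [Scheme.Opens.range_ι]
      rintro _ ⟨t, rfl⟩ ⟨y, hy⟩
      apply hab
      -- `Spec Ω` has one point, so a pair that meets the diagonal factors through it, and its
      -- coordinates agree.
      let l := IsOpenImmersion.lift Δ (pairing a b).left (by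
        rintro _ ⟨t', rfl⟩
        exact ⟨y, hy.trans (congrArg _ (Subsingleton.elim (α := Spec (.of Ω)) t t'))⟩)
      have hl : l ≫ Δ = (pairing a b).left := IsOpenImmersion.lift_fac _ _ _
      ext1
      calc a.left = (pairing a b).left ≫ pullback.fst _ _ := (pullback.lift_fst _ _ _).symm
        _ = l := by simp [← hl, Δ]
        _ = (pairing a b).left ≫ pullback.snd _ _ := by simp [← hl, Δ]
        _ = b.left := pullback.lift_snd _ _ _
    let l := IsOpenImmersion.lift U.ι (pairing a b).left hr
    have hl : l ≫ U.ι = (pairing a b).left := IsOpenImmersion.lift_fac _ _ _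
    let w : Over.mk x ⟶ Over.mk (U.ι ≫ pullback.fst Y.hom Y.hom ≫ Y.hom) := Over.homMk l (by
      have := Over.w (pairing a b)
      simp only [Over.mk_hom] at this ⊢
      rw [reassoc_of% hl, this])
    have hw : w ≫ ι = pairing a b := by ext1; exact hl
    exact ⟨w, by rw [← Category.assoc, hw, pairing_fst], by rw [← Category.assoc, hw, pairing_snd]⟩
  · have h1 := congrArg CommaMorphism.left hw
    simp only [Over.comp_left, ι, projFst, projSnd, Over.homMk_left] at h1
    have h2 : w.left ≫ U.ι = (w.left ≫ U.ι ≫ pullback.fst _ _) ≫ Δ := by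
      apply pullback.hom_ext
      · simp [Δ]
      · simpa [Δ] using h1.symm
    let t : Spec (.of Ω) := default
    have h3 : U.ι (w.left t) ∈ U := by
      rw [← SetLike.mem_coe, ← Scheme.Opens.range_ι]
      exact ⟨_, rfl⟩
    refine h3 ⟨(w.left ≫ U.ι ≫ pullback.fst _ _) t, ?_⟩
    rw [← Scheme.Hom.comp_apply, ← h2, Scheme.Hom.comp_apply]

/-- A pair of distinct points is a point of the off-diagonal covering `W`. Its image under `α` is
again a point of `W`, so the two images are distinct. -/
theorem fibre_hom_injective (α : fibre (isCovering X) x ⟶ fibre (isCovering X) x') (Y : Cov X) :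
    Function.Injective (α.app Y) := by
  intro a b hab
  by_contra hne
  obtain ⟨W, p, q, h1, h2⟩ := exists_offDiagonal Y.property
  obtain ⟨w, rfl, rfl⟩ := h1 x a b hne
  have hp := ConcreteCategory.congr_hom (α.naturality (Y := Y) (ObjectProperty.homMk p)) w
  have hq := ConcreteCategory.congr_hom (α.naturality (Y := Y) (ObjectProperty.homMk q)) w
  exact h2 x' (α.app W w) (hp.symm.trans (hab.trans hq))

/-- Coverings are stable under fibre products and equalizers, and a point that equalizes two maps
lifts to the equalizer. -/
instance isCofilteredOrEmpty_elements_fibre :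
    IsCofilteredOrEmpty (fibre (isCovering X) x).Elements where
  cone_objs Y Z := by
    refine ⟨⟨⟨_, isCovering_pullback Y.1.property Z.1.property⟩, pairing Y.2 Z.2⟩,
      ⟨ObjectProperty.homMk (projFst _ _), ?_⟩, ⟨ObjectProperty.homMk (projSnd _ _), ?_⟩, trivial⟩
    · exact pairing_fst _ _
    · exact pairing_snd _ _
  cone_maps Y Z f g := by
    obtain ⟨_, _⟩ := id Z.1.property
    let f' : Y.1.obj.left ⟶ Z.1.obj.left := f.1.hom.left
    let g' : Y.1.obj.left ⟶ Z.1.obj.left := g.1.hom.left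
    have hf : f' ≫ Z.1.obj.hom = Y.1.obj.hom := Over.w f.1.hom
    have hg : g' ≫ Z.1.obj.hom = Y.1.obj.hom := Over.w g.1.hom
    let d := pullback.lift f' g' (hf.trans hg.symm)
    have hd₁ : d ≫ pullback.fst _ _ = f' := pullback.lift_fst _ _ _
    have hd₂ : d ≫ pullback.snd _ _ = g' := pullback.lift_snd _ _ _
    -- The equalizer of `f'` and `g'` is the preimage of the diagonal under `(f', g')`. It is finite
    -- étale over the source because the diagonal is.
    let e := pullback.fst d (pullback.diagonal Z.1.obj.hom)
    have hy : Y.2.left ≫ f' = Y.2.left ≫ g' :=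
      congrArg CommaMorphism.left ((f.2.trans g.2.symm : Y.2 ≫ f.1.hom = Y.2 ≫ g.1.hom))
    let w : Over.mk x ⟶ Over.mk (e ≫ Y.1.obj.hom) :=
      Over.homMk (pullback.lift Y.2.left (Y.2.left ≫ f') (by
        apply pullback.hom_ext
        · simp [hd₁]
        · simp [hd₂, hy])) (by
        simp only [Over.mk_hom, e, pullback.lift_fst_assoc]
        exact Over.w Y.2)
    refine ⟨⟨⟨_, isCovering_comp Y.1.property e⟩, w⟩,
      ⟨ObjectProperty.homMk (Over.homMk e rfl), ?_⟩, ?_⟩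
    · change w ≫ Over.homMk e rfl = Y.2
      ext1
      exact pullback.lift_fst _ _ _
    · apply CategoryOfElements.ext
      apply ObjectProperty.hom_ext
      apply Over.OverMorphism.ext
      change e ≫ f' = e ≫ g'
      have h1 : e ≫ d = pullback.snd _ _ ≫ pullback.diagonal Z.1.obj.hom := pullback.condition
      have h2 := congrArg (· ≫ pullback.fst _ _) h1
      have h3 := congrArg (· ≫ pullback.snd _ _) h1
      simp only [Category.assoc, hd₁, hd₂,
        pullback.diagonal_fst, pullback.diagonal_snd] at h2 h3
      exact h2.trans h3.symm

/-- A natural transformation out of the fibre functor at `x` is a compatible choice, for each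
covering pointed above `x`, of a point above `x'`. Such choices exist by compactness: the system is
cofiltered with finite nonempty terms. -/
theorem nonempty_fibre_hom [ConnectedSpace X] [IsSepClosed Ω']
    (x : Spec (.of Ω) ⟶ X) (x' : Spec (.of Ω') ⟶ X) :
    Nonempty (fibre (isCovering X) x ⟶ fibre (isCovering X) x') := by
  let G := CategoryOfElements.π (fibre (isCovering X) x) ⋙ fibre (isCovering X) x'
  have h1 (j) : Finite (G.obj j) := finite_points j.1.property x'
  have h2 (j) : Nonempty (G.obj j) := by
    have : Nonempty j.1.obj.left := ⟨j.2.left (default : Spec (.of Ω))⟩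
    exact exists_point j.1.property x'
  obtain ⟨t, ht⟩ := nonempty_sections_of_finite_cofiltered_system G
  exact ⟨{ app := fun Y => TypeCat.ofHom fun a => t ⟨Y, a⟩
           naturality := fun Y Z f => by
            ext a
            exact (ht (j := ⟨Y, a⟩) (j' := ⟨Z, (fibre (isCovering X) x).map f a⟩) ⟨f, rfl⟩).symm }⟩

/-- Any two geometric points of a connected scheme are joined by a path. -/
theorem nonempty_fibre_iso [ConnectedSpace X] [IsSepClosed Ω] [IsSepClosed Ω']
    (x : Spec (.of Ω) ⟶ X) (x' : Spec (.of Ω') ⟶ X) :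
    Nonempty (fibre (isCovering X) x ≅ fibre (isCovering X) x') := by
  obtain ⟨α⟩ := nonempty_fibre_hom x x'
  obtain ⟨β⟩ := nonempty_fibre_hom x' x
  have (Y : Cov X) : IsIso (α.app Y) := by
    have : Finite ((fibre (isCovering X) x).obj Y) := finite_points Y.property x
    have : Finite ((fibre (isCovering X) x').obj Y) := finite_points Y.property x'
    rw [isIso_iff_bijective]
    -- `β` need not be inverse to `α`: injections both ways between finite sets force `α` to be
    -- bijective on each fibre.
    exact (Function.Injective.bijective_of_nat_card_le (fibre_hom_injective α Y)
      (Nat.card_le_card_of_injective _ (fibre_hom_injective β Y)))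
  have : IsIso α := NatIso.isIso_of_isIso_app α
  exact ⟨asIso α⟩

end Path

/-! ### Triviality of `G_K^{m+}` on bounded coverings and on the stalk -/

section Bounded

variable {k : Type u} [Field k] {X : Scheme.{u}} {s : X ⟶ Spec (.of k)} [IsVariety s]
  {Xb : Compactification s}

/-- The ramification groups act trivially on the points of a covering with bounded ramification. -/
theorem sepHom_comp_of_hasBoundedRamification {D : BoundaryDivisor Xb} {Y : Over X}
    (hY : HasBoundedRamification D Y) (P : PointAtInfinity Xb)
    {σ : Gal(SeparableClosure P.K/P.K)} (hσ : σ ∈ absUpperGroupPlus P.O (P.mult D))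
    (y : SmoothSheaf.sepPoint P.toX ⟶ Y) : SmoothSheaf.sepHom P.toX σ ≫ y = y := by
  let q : Spec (.of (SeparableClosure P.K)) ⟶ Spec (.of P.K) :=
    Spec.map (CommRingCat.ofHom (algebraMap P.K (SeparableClosure P.K)))
  have hw : y.left ≫ Y.hom = q ≫ P.toX := Over.w y
  let l : Spec (.of (SeparableClosure P.K)) ⟶ pullback Y.hom P.toX := pullback.lift y.left q hw
  have hl₁ : l ≫ pullback.fst _ _ = y.left := pullback.lift_fst _ _ _
  have hl₂ : l ≫ pullback.snd _ _ = q := pullback.lift_snd _ _ _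
  -- The `K^sep`-point factors through the residue field at its image `t`. The map `e` is then one
  -- of the embeddings over which `RamificationBounded` quantifies.
  let t := l (IsLocalRing.closedPoint _)
  let e := Scheme.descResidueField (Scheme.stalkClosedPointTo l)
  have he : Spec.map e ≫ (pullback Y.hom P.toX).fromSpecResidueField t = l :=
    Scheme.descResidueField_stalkClosedPointTo_fromSpecResidueField _ _ l
  have hfix := hY P t e.hom (by
    have h1 : Spec.preimage ((pullback Y.hom P.toX).fromSpecResidueField t ≫ pullback.snd _ _) ≫ e =
        CommRingCat.ofHom (algebraMap P.K (SeparableClosure P.K)) :=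
      Spec.map_injective (by rw [Spec.map_comp, Spec.map_preimage, reassoc_of% he, hl₂])
    exact congrArg CommRingCat.Hom.hom h1) σ hσ
  have hσe : e ≫ CommRingCat.ofHom (σ : SeparableClosure P.K →+* SeparableClosure P.K) = e :=
    CommRingCat.hom_ext (RingHom.ext hfix)
  ext1
  change Spec.map (CommRingCat.ofHom (σ : SeparableClosure P.K →+* SeparableClosure P.K)) ≫
    y.left = y.left
  rw [← hl₁, ← he, ← Category.assoc, ← Category.assoc, ← Spec.map_comp, hσe]

theorem restrictHom_galoisConj_eq_one {D : BoundaryDivisor Xb} {Ω : Type u} [Field Ω]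
    {x : Spec (.of Ω) ⟶ X} (P : PointAtInfinity Xb)
    (e : fibre (isCovering X) x ≅ fibre (isCovering X) (sepPointHom P.toX))
    {σ : Gal(SeparableClosure P.K/P.K)} (hσ : σ ∈ absUpperGroupPlus P.O (P.mult D)) :
    restrictHom (isBoundedCovering_le D) x (galoisConj e σ) = 1 := by
  apply Iso.ext
  ext Y y
  let Y' : Cov X := ⟨Y.obj, Y.property.1⟩
  -- On a bounded covering the middle factor of the conjugate `e ≫ σ ≫ e⁻¹` is the identity, so the
  -- path cancels.
  exact (congrArg (e.inv.app Y') (sepHom_comp_of_hasBoundedRamification Y.property.2 P hσ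
    (e.hom.app Y' y))).trans (ConcreteCategory.congr_hom (e.hom_inv_id_app Y') y)

theorem SmoothSheaf.FactorsThrough.galoisRep_eq_one {ℓ : ℕ} [Fact ℓ.Prime] {F : SmoothSheaf ℓ X}
    {D : BoundaryDivisor Xb} {Ω : Type u} [Field Ω] {x : Spec (.of Ω) ⟶ X}
    (hF : F.FactorsThrough x D) (P : PointAtInfinity Xb)
    (e : fibre (isCovering X) x ≅ fibre (isCovering X) (sepPointHom P.toX))
    {σ : Gal(SeparableClosure P.K/P.K)} (hσ : σ ∈ absUpperGroupPlus P.O (P.mult D)) :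
    F.galoisRep P.toX σ = 1 := by
  obtain ⟨ρ, hρ⟩ := hF
  have h1 : F.monodromy x (galoisConj e σ) = LinearMap.id := by
    rw [hρ, MonoidHom.comp_apply, restrictHom_galoisConj_eq_one P e hσ, map_one]
    rfl
  rw [galoisRep_eq_conj_monodromy F P.toX e, h1, LinearMap.id_comp, ← stalkMap_comp,
    e.inv_hom_id, stalkMap_id]
  rfl

end Bounded

end SwanBound

end

/-! ### The bound on the Swan conductor -/

open CategoryTheory AlgebraicGeometry SwanBound in
theorem mainTheorem7 {k : Type u} [Field k] [Finite k] (ℓ : ℕ) [Fact ℓ.Prime] (hℓ : (ℓ : k) ≠ 0)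
    {X : Scheme.{u}} (s : X ⟶ Spec (.of k)) [IsVariety s] (Xb : Compactification s)
    {Ω : Type u} [Field Ω] [IsSepClosed Ω] (x : Spec (.of Ω) ⟶ X)
    (F : SmoothSheaf ℓ X) (r : ℕ) (hr : F.HasRank x r)
    (D : BoundaryDivisor Xb) (hF : F.FactorsThrough x D) :
    F.SwanLE (D.smul r) := by
  have : ConnectedSpace X := IsVariety.connected s
  intro P
  obtain ⟨e⟩ := nonempty_fibre_iso x (sepPointHom P.toX)
  have hfin : Module.Finite (PadicAlgCl ℓ) (F.stalk (Over.mk x)) :=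
    Module.rank_lt_aleph0_iff.1 (by rw [hr]; exact Cardinal.natCast_lt_aleph0)
  -- The rank is given at `x`; the path carries it to the geometric point over `k(C)_z`.
  have hfin' : FiniteDimensional (PadicAlgCl ℓ) (F.stalk (SmoothSheaf.sepPoint P.toX)) :=
    Module.Finite.equiv (F.stalkEquiv e)
  have hrank : Module.finrank (PadicAlgCl ℓ) (F.stalk (SmoothSheaf.sepPoint P.toX)) = r :=
    (F.stalkEquiv e).finrank_eq.symm.trans (Module.finrank_eq_of_rank_eq hr)
  refine (swan_le P.O (F.galoisRep P.toX) (P.mult D) fun σ hσ =>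
    hF.galoisRep_eq_one P e hσ).trans ?_
  rw [hrank, P.mult_smul, mul_comm, Nat.cast_mul]
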